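/- **Theorem 3.2.** Let $\Omega\subset\mathbb R^d$ be a bounded domain (with smooth or arbitrary boundary), and let $(e_n)_{n\ge1}$ be an orthonormal basis of $L^2(\Omega)$ consisting of eigenfunctions of the Dirichlet Laplacian, i.e. $e_n\in H^1_0(\Omega)$ and $-\Delta e_n=\lambda_n e_n$ weakly, with $0<\lambda_1\le\lambda_2\le\cdots$. For $\varrho\ge 0$ let $$\mathbb H^\varrho=\Big\{\varphi\in L^2(\Omega):\ \|\varphi\|_{\mathbb H^\varrho}^2:=\sum_{n}\Big|\lambda_n^{\varrho/2}\int_\Omega\varphi e_n\,dx\Big|^2<\infty\Big\},$$ and let $\mathbb H^{-\varrho}$ be the dual space of $\mathbb H^{\varrho}$, with $\|\psi\|^2_{\mathbb H^{-\varrho}}=\sum_n|\lambda_n^{-\varrho/2}\langle\psi,e_n\rangle|^2$ (for $\varrho=0$, $L^2(\Omega)$ is identified with its dual). Let $m\in L^1_{loc}([0,\infty))$ be nonnegative and such that $a=1+m$ is completely positive, i.e. for every $\theta>0$ the solutions $s,r$ of $$s(t)+\theta\int_0^t a(t-\tau)s(\tau)\,d\tau=1\ (t\ge 0),\qquad r(t)+\theta\int_0^t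 a(t-\tau)r(\tau)\,d\tau=a(t)\ (t>0)$$ are nonnegative. For $\lambda>0$ let $\omega(\cdot,\lambda)$ be the solution of $\omega(t,\lambda)+\lambda\int_0^t(1+m(t-\tau))\,\omega(\tau,\lambda)\,d\tau=1$, $t\ge0$, and let $$S(t)v=\sum_{n}\omega(t,\lambda_n)\langle v,e_n\rangle e_n .$$ Let $T>0$, $\ell\in L^1(0,T)$ and $\mathcal Hv(t)=\int_0^t\ell(t-\tau)v(\tau)\,d\tau$. Let $\mu>0$, $\delta\in(0,1)$, and let $f:\mathbb H^\mu\times\mathbb H^\mu\to\mathbb H^{\mu-1-\delta}$ be continuous with $$\|f(v_1,w_1)-f(v_2,w_2)\|_{\mathbb H^{\mu-1-\delta}}\le L_f^*\|v_1-v_2\|_{\mathbb H^\mu}+K_f^*\|w_1-w_2\|_{\mathbb H^\mu}\quad\text{for all }v_1,v_2,w_1,w_2\in\mathbb H^\mu,$$ where $L_f^*,K_f^*\ge0$ are constants. Then for every $\xi\in\mathbb H^\mu$ the problem $$\partial_tu-(1+D_t^{\{m\}})\Delta u=f(u,\mathcal Hu)\ \text{in }\Omega\times(0,T),\qquad u=0\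 \text{on }\partial\Omega,\qquad u(0)=\xi,$$ where $D_t^{\{m\}}v(t)=\frac{d}{dt}\int_0^tm(t-s)v(s)\,ds$, has exactly one mild solution in $C([0,T];\mathbb H^\mu)$, that is, there is exactly one $u\in C([0,T];\mathbb H^\mu)$ with $$u(t)=S(t)\xi+\int_0^tS(t-\tau)f(u(\tau),\mathcal Hu(\tau))\,d\tau\quad\text{in }\mathbb H^\mu,\qquad t\in[0,T].$$ -/

import Mathlib

open MeasureTheory Set
open scoped ContDiff

noncomputable section

namespace RayleighStokes

/-! ### The Dirichlet Laplacian on `Ω ⊆ ℝ^d` and its eigenfunctions -/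

/-- The real Hilbert space `L²(Ω)`. -/
abbrev L2 {d : ℕ} (Ω : Set (EuclideanSpace ℝ (Fin d))) : Type :=
  Lp ℝ 2 (volume.restrict Ω)

/-- The Hilbert space `L²(Ω; ℝ^d)` of square integrable vector fields. -/
abbrev L2Vec {d : ℕ} (Ω : Set (EuclideanSpace ℝ (Fin d))) : Type :=
  Lp (EuclideanSpace ℝ (Fin d)) 2 (volume.restrict Ω)

/-- `ψ ∈ C_c^∞(Ω)`. -/
def IsTestFunction {d : ℕ} (Ω : Set (EuclideanSpace ℝ (Fin d)))
    (ψ : EuclideanSpace ℝ (Fin d) → ℝ) : Prop :=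
  ContDiff ℝ ∞ ψ ∧ HasCompactSupport ψ ∧ tsupport ψ ⊆ Ω

/-- The pairs `(φ, ∇φ)` with `φ ∈ H₀¹(Ω)`: the closure in `L²(Ω) × L²(Ω; ℝ^d)`, that is for the
norm of `H¹(Ω)`, of the pairs `(ψ, ∇ψ)` with `ψ ∈ C_c^∞(Ω)`. -/
def H10Graph {d : ℕ} (Ω : Set (EuclideanSpace ℝ (Fin d))) : Set (L2 Ω × L2Vec Ω) :=
  closure {p | ∃ ψ : EuclideanSpace ℝ (Fin d) → ℝ, IsTestFunction Ω ψ ∧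
    p.1 =ᵐ[volume.restrict Ω] ψ ∧ p.2 =ᵐ[volume.restrict Ω] gradient ψ}

/-- `φ ∈ H₀¹(Ω)` and `-Δ φ = θ φ` weakly in `Ω`, i.e. `∫_Ω ∇φ · ∇ψ = θ ∫_Ω φ ψ` for all
`ψ ∈ C_c^∞(Ω)`. -/
def SolvesDirichletEigen {d : ℕ} (Ω : Set (EuclideanSpace ℝ (Fin d))) (θ : ℝ) (φ : L2 Ω) : Prop :=
  ∃ G : L2Vec Ω, (φ, G) ∈ H10Graph Ω ∧
    ∀ ψ : EuclideanSpace ℝ (Fin d) → ℝ, IsTestFunction Ω ψ →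
      ∫ x in Ω, inner ℝ (G x) (gradient ψ x) = θ * ∫ x in Ω, φ x * ψ x

/-- An orthonormal basis `(e_n)` of `L²(Ω)` that consists of eigenfunctions of the Dirichlet
Laplacian `-Δ`, with the eigenvalues `λ_n > 0` listed in nondecreasing order. -/
structure DirichletEigenbasis {d : ℕ} (Ω : Set (EuclideanSpace ℝ (Fin d))) where
  /-- the eigenfunctions `e_n` -/
  e : HilbertBasis ℕ ℝ (L2 Ω)
  /-- the eigenvalues `λ_n` -/
  lam : ℕ → ℝ
  lam_pos : ∀ n, 0 < lam n
  lam_mono : Monotone lam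
  eigen : ∀ n, SolvesDirichletEigen Ω (lam n) (e n)

namespace DirichletEigenbasis

variable {d : ℕ} {Ω : Set (EuclideanSpace ℝ (Fin d))}

/-! ### The spaces `ℍ^ρ`, `ρ ≥ 0`, of functions -/

/-- The functions `φ ∈ L²(Ω)` for which `λ_n^{ρ/2} ∫_Ω φ e_n` is square summable. -/
def HSubmodule (E : DirichletEigenbasis Ω) (ρ : ℝ) : Submodule ℝ (L2 Ω) where
  carrier := {φ | Memℓp (fun n => E.lam n ^ (ρ / 2) * inner ℝ (E.e n) φ) 2}
  zero_mem' := by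
    have h : (fun n => E.lam n ^ (ρ / 2) * inner ℝ (E.e n) (0 : L2 Ω)) = 0 := by
      funext n; simp
    simpa only [mem_ofPred_eq, h] using (zero_memℓp : Memℓp (0 : ℕ → ℝ) 2)
  add_mem' := by
    intro φ ψ hφ hψ
    have h : (fun n => E.lam n ^ (ρ / 2) * inner ℝ (E.e n) (φ + ψ)) =
        (fun n => E.lam n ^ (ρ / 2) * inner ℝ (E.e n) φ) +
          fun n => E.lam n ^ (ρ / 2) * inner ℝ (E.e n) ψ := by
      funext n; simp only [inner_add_right, Pi.add_apply]; ring
    simp only [mem_ofPred_eq, h] at hφ hψ ⊢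
    exact hφ.add hψ
  smul_mem' := by
    intro c φ hφ
    have h : (fun n => E.lam n ^ (ρ / 2) * inner ℝ (E.e n) (c • φ)) =
        c • fun n => E.lam n ^ (ρ / 2) * inner ℝ (E.e n) φ := by
      funext n; simp only [inner_smul_right, Pi.smul_apply, smul_eq_mul]; ring
    simp only [mem_ofPred_eq, h] at hφ ⊢
    exact hφ.const_smul c

/-- `ℍ^ρ` for `ρ ≥ 0`. It carries the norm `‖φ‖² = ∑ |λ_n^{ρ/2} ∫_Ω φ e_n|²`
(see `H.norm_sq`), not that of `L²(Ω)`. -/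
def H (E : DirichletEigenbasis Ω) (ρ : ℝ) : Type := ↥(E.HSubmodule ρ)

instance (E : DirichletEigenbasis Ω) (ρ : ℝ) : AddCommGroup (E.H ρ) :=
  inferInstanceAs (AddCommGroup ↥(E.HSubmodule ρ))

instance (E : DirichletEigenbasis Ω) (ρ : ℝ) : Module ℝ (E.H ρ) :=
  inferInstanceAs (Module ℝ ↥(E.HSubmodule ρ))

/-- The inclusion `ℍ^ρ ⊆ L²(Ω)`. -/
def H.toL2 {E : DirichletEigenbasis Ω} {ρ : ℝ} : E.H ρ →ₗ[ℝ] L2 Ω := (E.HSubmodule ρ).subtype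

/-- The coefficient `φ_n = ∫_Ω φ e_n`. -/
def H.coeff {E : DirichletEigenbasis Ω} {ρ : ℝ} (φ : E.H ρ) (n : ℕ) : ℝ :=
  inner ℝ (E.e n) (H.toL2 φ)

theorem H.coeff_eq_integral {E : DirichletEigenbasis Ω} {ρ : ℝ} (φ : E.H ρ) (n : ℕ) :
    φ.coeff n = ∫ x in Ω, H.toL2 φ x * E.e n x := by
  simp [H.coeff, L2.inner_def]

/-- The weighted coefficients `(λ_n^{ρ/2} φ_n)_n`, as an element of `ℓ²`. -/
def H.weighted (E : DirichletEigenbasis Ω) (ρ : ℝ) : E.H ρ →ₗ[ℝ] lp (fun _ : ℕ => ℝ) 2 where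
  toFun φ := ⟨fun n => E.lam n ^ (ρ / 2) * φ.coeff n, φ.2⟩
  map_add' φ ψ := by
    ext n
    simp only [H.coeff, map_add, inner_add_right, mul_add, lp.coeFn_add, Pi.add_apply]
  map_smul' c φ := by
    ext n
    simp only [H.coeff, map_smul, inner_smul_right, lp.coeFn_smul, Pi.smul_apply, smul_eq_mul,
      RingHom.id_apply]
    ring

theorem lam_rpow_pos (E : DirichletEigenbasis Ω) (n : ℕ) (r : ℝ) : 0 < E.lam n ^ r :=
  Real.rpow_pos_of_pos (E.lam_pos n) r

theorem H.ext_coeff {E : DirichletEigenbasis Ω} {ρ : ℝ} {φ ψ : E.H ρ}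
    (h : ∀ n, φ.coeff n = ψ.coeff n) : φ = ψ := by
  have h2 : E.e.repr (H.toL2 φ) = E.e.repr (H.toL2 ψ) := by
    ext n
    rw [HilbertBasis.repr_apply_apply, HilbertBasis.repr_apply_apply]
    exact h n
  exact Subtype.ext (E.e.repr.injective h2)

theorem H.weighted_apply {E : DirichletEigenbasis Ω} {ρ : ℝ} (φ : E.H ρ) (n : ℕ) :
    H.weighted E ρ φ n = E.lam n ^ (ρ / 2) * φ.coeff n := rfl

theorem H.weighted_injective (E : DirichletEigenbasis Ω) (ρ : ℝ) :
    Function.Injective (H.weighted E ρ) := by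
  intro φ ψ h
  refine H.ext_coeff fun n => ?_
  have h1 : E.lam n ^ (ρ / 2) * φ.coeff n = E.lam n ^ (ρ / 2) * ψ.coeff n :=
    congrFun (congrArg (fun x : lp (fun _ : ℕ => ℝ) 2 => (x : ℕ → ℝ)) h) n
  exact mul_left_cancel₀ (E.lam_rpow_pos n _).ne' h1

instance (E : DirichletEigenbasis Ω) (ρ : ℝ) : NormedAddCommGroup (E.H ρ) :=
  NormedAddCommGroup.induced (E.H ρ) (lp (fun _ : ℕ => ℝ) 2) (H.weighted E ρ)
    (H.weighted_injective E ρ)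

instance (E : DirichletEigenbasis Ω) (ρ : ℝ) : NormedSpace ℝ (E.H ρ) :=
  NormedSpace.induced ℝ (E.H ρ) (lp (fun _ : ℕ => ℝ) 2) (H.weighted E ρ)

theorem H.norm_weighted {E : DirichletEigenbasis Ω} {ρ : ℝ} (φ : E.H ρ) :
    ‖H.weighted E ρ φ‖ = ‖φ‖ := rfl

theorem H.norm_sq {E : DirichletEigenbasis Ω} {ρ : ℝ} (φ : E.H ρ) :
    ‖φ‖ ^ 2 = ∑' n, |E.lam n ^ (ρ / 2) * φ.coeff n| ^ 2 := by
  have h := lp.norm_rpow_eq_tsum (p := 2) (by norm_num) (H.weighted E ρ φ)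
  norm_num at h
  simp only [sq_abs]
  exact h

/-- The eigenfunction `e_n` as an element of `ℍ^ρ`. -/
def H.eig (E : DirichletEigenbasis Ω) (ρ : ℝ) (n : ℕ) : E.H ρ :=
  ⟨E.e n, by
    have h : (fun k => E.lam k ^ (ρ / 2) * inner ℝ (E.e k) (E.e n)) =
        (lp.single 2 n (E.lam n ^ (ρ / 2)) : lp (fun _ : ℕ => ℝ) 2) := by
      funext k
      rw [orthonormal_iff_ite.mp E.e.orthonormal k n]
      by_cases hk : k = n
      · subst hk; simp
      · simp [hk]
    change Memℓp _ 2
    rw [h]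
    exact lp.memℓp _⟩

theorem H.weighted_eig (E : DirichletEigenbasis Ω) (ρ : ℝ) (n : ℕ) :
    H.weighted E ρ (H.eig E ρ n) = lp.single 2 n (E.lam n ^ (ρ / 2)) := by
  ext k
  change E.lam k ^ (ρ / 2) * inner ℝ (E.e k) (E.e n) = _
  rw [orthonormal_iff_ite.mp E.e.orthonormal k n]
  by_cases hk : k = n
  · subst hk; simp
  · simp [hk]

theorem H.hasSum_eig {E : DirichletEigenbasis Ω} {ρ : ℝ} (φ : E.H ρ) :
    HasSum (fun n => φ.coeff n • H.eig E ρ n) φ := by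
  have hind : Topology.IsInducing (H.weighted E ρ) := ⟨rfl⟩
  refine (hind.hasSum_iff (g := H.weighted E ρ) _ φ).mp ?_
  have h := lp.hasSum_single (p := 2) (by norm_num) (H.weighted E ρ φ)
  convert h using 2 with n
  simp only [Function.comp, map_smul, H.weighted_eig]
  rw [← lp.single_smul]
  congr 1
  change _ = E.lam n ^ (ρ / 2) * φ.coeff n
  rw [smul_eq_mul, mul_comm]

theorem H.isometry_weighted (E : DirichletEigenbasis Ω) (ρ : ℝ) : Isometry (H.weighted E ρ) :=
  AddMonoidHomClass.isometry_of_norm _ fun _ => rfl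

theorem memlp_mul (E : DirichletEigenbasis Ω) {r : ℝ} (hr : r ≤ 0)
    (c : lp (fun _ : ℕ => ℝ) 2) : Memℓp (fun n => E.lam n ^ r * c n) 2 := by
  have hb : Memℓp ((E.lam 0 ^ r) • (c : ℕ → ℝ)) 2 := (lp.memℓp c).const_smul _
  refine memℓp_gen ((hb.summable (by norm_num)).of_nonneg_of_le (fun n => by positivity) ?_)
  intro n
  simp only [Pi.smul_apply, smul_eq_mul, norm_mul]
  gcongr
  rw [Real.norm_of_nonneg (E.lam_rpow_pos _ _).le, Real.norm_of_nonneg (E.lam_rpow_pos _ _).le]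
  exact Real.rpow_le_rpow_of_nonpos (E.lam_pos 0) (E.lam_mono (Nat.zero_le n)) hr

theorem H.weighted_surjective (E : DirichletEigenbasis Ω) {ρ : ℝ} (hρ : 0 ≤ ρ) :
    Function.Surjective (H.weighted E ρ) := by
  intro c
  have hc : Memℓp (fun n => E.lam n ^ (-(ρ / 2)) * c n) 2 := E.memlp_mul (by linarith) c
  have hrepr : ∀ n, inner ℝ (E.e n) (E.e.repr.symm ⟨_, hc⟩) = E.lam n ^ (-(ρ / 2)) * c n := by
    intro n
    rw [← HilbertBasis.repr_apply_apply, LinearIsometryEquiv.apply_symm_apply]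
  have hw : (fun n => E.lam n ^ (ρ / 2) * inner ℝ (E.e n) (E.e.repr.symm ⟨_, hc⟩)) = c := by
    funext n
    rw [hrepr, ← mul_assoc, ← Real.rpow_add (E.lam_pos n)]
    simp
  refine ⟨⟨E.e.repr.symm ⟨_, hc⟩, ?_⟩, ?_⟩
  · change Memℓp _ 2
    rw [hw]
    exact lp.memℓp c
  · exact lp.ext hw

/-- For `ρ ≥ 0` the space `ℍ^ρ` is complete, so that integrals in it are meaningful. -/
theorem H.completeSpace (E : DirichletEigenbasis Ω) {ρ : ℝ} (hρ : 0 ≤ ρ) :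
    CompleteSpace (E.H ρ) :=
  ((H.isometry_weighted E ρ).isUniformInducing.completeSpace_congr
    (H.weighted_surjective E hρ)).mpr inferInstance

/-! ### The full scale `ℍ^s`, `s ∈ ℝ` -/

/-- The functionals `ψ` on `ℍ^{max(0,-s)}` for which `λ_n^{s/2} ⟨ψ, e_n⟩` is square summable. -/
def HScaleSubmodule (E : DirichletEigenbasis Ω) (s : ℝ) :
    Submodule ℝ (StrongDual ℝ (E.H (max 0 (-s)))) where
  carrier := {ψ | Memℓp (fun n => E.lam n ^ (s / 2) * ψ (H.eig E (max 0 (-s)) n)) 2}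
  zero_mem' := by
    have h : (fun n => E.lam n ^ (s / 2) *
        (0 : StrongDual ℝ (E.H (max 0 (-s)))) (H.eig E (max 0 (-s)) n)) = 0 := by
      funext n; simp
    simpa only [mem_ofPred_eq, h] using (zero_memℓp : Memℓp (0 : ℕ → ℝ) 2)
  add_mem' := by
    intro φ ψ hφ hψ
    have h : (fun n => E.lam n ^ (s / 2) * (φ + ψ) (H.eig E (max 0 (-s)) n)) =
        (fun n => E.lam n ^ (s / 2) * φ (H.eig E (max 0 (-s)) n)) +
          fun n => E.lam n ^ (s / 2) * ψ (H.eig E (max 0 (-s)) n) := by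
      funext n; simp [mul_add]
    simp only [mem_ofPred_eq, h] at hφ hψ ⊢
    exact hφ.add hψ
  smul_mem' := by
    intro c φ hφ
    have h : (fun n => E.lam n ^ (s / 2) * (c • φ) (H.eig E (max 0 (-s)) n)) =
        c • fun n => E.lam n ^ (s / 2) * φ (H.eig E (max 0 (-s)) n) := by
      funext n; simp; ring
    simp only [mem_ofPred_eq, h] at hφ ⊢
    exact hφ.const_smul c

/-- `ℍ^s` for every real `s`, with the norm `‖ψ‖² = ∑ |λ_n^{s/2} ⟨ψ, e_n⟩|²`
(see `HScale.norm_sq`).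
For `s ≤ 0` this is the whole dual space of `ℍ^{-s}` (see `HScaleSubmodule_eq_top`).
For `s ≥ 0` its elements are the functionals `v ↦ ∫_Ω φ v` on `ℍ^0 = L²(Ω)` with `φ ∈ ℍ^s`
(see `HScale.exists_of_nonneg` and `HScale.exists_coeff_eq`),
that is, `L²(Ω)` is identified with its dual as usual. -/
def HScale (E : DirichletEigenbasis Ω) (s : ℝ) : Type := ↥(E.HScaleSubmodule s)

instance (E : DirichletEigenbasis Ω) (s : ℝ) : AddCommGroup (E.HScale s) :=
  inferInstanceAs (AddCommGroup ↥(E.HScaleSubmodule s))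

instance (E : DirichletEigenbasis Ω) (s : ℝ) : Module ℝ (E.HScale s) :=
  inferInstanceAs (Module ℝ ↥(E.HScaleSubmodule s))

/-- The functional `v ↦ ⟨ψ, v⟩` on `ℍ^{max(0,-s)}`. -/
def HScale.toDual {E : DirichletEigenbasis Ω} {s : ℝ} :
    E.HScale s →ₗ[ℝ] StrongDual ℝ (E.H (max 0 (-s))) := (E.HScaleSubmodule s).subtype

/-- The coefficient `⟨ψ, e_n⟩`. -/
def HScale.coeff {E : DirichletEigenbasis Ω} {s : ℝ} (ψ : E.HScale s) (n : ℕ) : ℝ :=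
  HScale.toDual ψ (H.eig E (max 0 (-s)) n)

/-- The weighted coefficients `(λ_n^{s/2} ⟨ψ, e_n⟩)_n`, as an element of `ℓ²`. -/
def HScale.weighted (E : DirichletEigenbasis Ω) (s : ℝ) :
    E.HScale s →ₗ[ℝ] lp (fun _ : ℕ => ℝ) 2 where
  toFun ψ := ⟨fun n => E.lam n ^ (s / 2) * ψ.coeff n, ψ.2⟩
  map_add' φ ψ := by
    ext n
    simp only [HScale.coeff, map_add, _root_.add_apply, mul_add, lp.coeFn_add,
      Pi.add_apply]
  map_smul' c φ := by
    ext n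
    simp only [HScale.coeff, map_smul, _root_.smul_apply, lp.coeFn_smul,
      Pi.smul_apply, smul_eq_mul, RingHom.id_apply]
    ring

theorem HScale.hasSum_coeff {E : DirichletEigenbasis Ω} {s : ℝ} (ψ : E.HScale s)
    (v : E.H (max 0 (-s))) : HasSum (fun n => v.coeff n * ψ.coeff n) (HScale.toDual ψ v) := by
  have h := (H.hasSum_eig v).mapL (HScale.toDual ψ)
  simp only [map_smul, smul_eq_mul] at h
  exact h

theorem HScale.ext_coeff {E : DirichletEigenbasis Ω} {s : ℝ} {φ ψ : E.HScale s}
    (h : ∀ n, φ.coeff n = ψ.coeff n) : φ = ψ := by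
  refine Subtype.ext (ContinuousLinearMap.ext fun v => ?_)
  have h1 := φ.hasSum_coeff v
  simp only [h] at h1
  exact h1.unique (ψ.hasSum_coeff v)

theorem HScale.weighted_apply {E : DirichletEigenbasis Ω} {s : ℝ} (ψ : E.HScale s) (n : ℕ) :
    HScale.weighted E s ψ n = E.lam n ^ (s / 2) * ψ.coeff n := rfl

theorem HScale.weighted_injective (E : DirichletEigenbasis Ω) (s : ℝ) :
    Function.Injective (HScale.weighted E s) := by
  intro φ ψ h
  refine HScale.ext_coeff fun n => ?_
  have h1 : E.lam n ^ (s / 2) * φ.coeff n = E.lam n ^ (s / 2) * ψ.coeff n :=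
    congrFun (congrArg (fun x : lp (fun _ : ℕ => ℝ) 2 => (x : ℕ → ℝ)) h) n
  exact mul_left_cancel₀ (E.lam_rpow_pos n _).ne' h1

instance (E : DirichletEigenbasis Ω) (s : ℝ) : NormedAddCommGroup (E.HScale s) :=
  NormedAddCommGroup.induced (E.HScale s) (lp (fun _ : ℕ => ℝ) 2) (HScale.weighted E s)
    (HScale.weighted_injective E s)

instance (E : DirichletEigenbasis Ω) (s : ℝ) : NormedSpace ℝ (E.HScale s) :=
  NormedSpace.induced ℝ (E.HScale s) (lp (fun _ : ℕ => ℝ) 2) (HScale.weighted E s)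

theorem HScale.norm_weighted {E : DirichletEigenbasis Ω} {s : ℝ} (ψ : E.HScale s) :
    ‖HScale.weighted E s ψ‖ = ‖ψ‖ := rfl

theorem HScale.norm_sq {E : DirichletEigenbasis Ω} {s : ℝ} (ψ : E.HScale s) :
    ‖ψ‖ ^ 2 = ∑' n, |E.lam n ^ (s / 2) * ψ.coeff n| ^ 2 := by
  have h := lp.norm_rpow_eq_tsum (p := 2) (by norm_num) (HScale.weighted E s ψ)
  norm_num at h
  simp only [sq_abs]
  exact h

theorem HScale.weighted_surjective (E : DirichletEigenbasis Ω) (s : ℝ) :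
    Function.Surjective (HScale.weighted E s) := by
  intro c
  have hr : -((s + max 0 (-s)) / 2) ≤ 0 := by
    have := le_max_right 0 (-s)
    linarith
  let c' : lp (fun _ : ℕ => ℝ) 2 := ⟨_, E.memlp_mul hr c⟩
  let J : E.H (max 0 (-s)) →L[ℝ] lp (fun _ : ℕ => ℝ) 2 :=
    ⟨H.weighted E _, (H.isometry_weighted E _).continuous⟩
  let ψ : StrongDual ℝ (E.H (max 0 (-s))) := (innerSL ℝ c').comp J
  have hψ : ∀ n, ψ (H.eig E _ n) = E.lam n ^ (-(s / 2)) * c n := by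
    intro n
    change inner ℝ c' (H.weighted E _ (H.eig E _ n)) = _
    rw [H.weighted_eig, lp.inner_single_right]
    change E.lam n ^ (max 0 (-s) / 2) * (E.lam n ^ (-((s + max 0 (-s)) / 2)) * c n) = _
    rw [← mul_assoc, ← Real.rpow_add (E.lam_pos n)]
    ring_nf
  have hw : (fun n => E.lam n ^ (s / 2) * ψ (H.eig E _ n)) = c := by
    funext n
    rw [hψ, ← mul_assoc, ← Real.rpow_add (E.lam_pos n)]
    simp
  refine ⟨⟨ψ, ?_⟩, ?_⟩
  · change Memℓp _ 2
    rw [hw]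
    exact lp.memℓp c
  · exact lp.ext hw

/-- For `s ≤ 0` every continuous functional on `ℍ^{-s}` belongs to `ℍ^s`. -/
theorem HScaleSubmodule_eq_top (E : DirichletEigenbasis Ω) {s : ℝ} (hs : s ≤ 0) :
    E.HScaleSubmodule s = ⊤ := by
  refine eq_top_iff.mpr fun ψ _ => ?_
  have hr : max 0 (-s) = -s := max_eq_right (by linarith)
  let J : E.H (max 0 (-s)) ≃ₗᵢ[ℝ] lp (fun _ : ℕ => ℝ) 2 :=
    LinearIsometryEquiv.ofSurjective ⟨H.weighted E _, fun _ => rfl⟩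
      (H.weighted_surjective E (le_max_left _ _))
  let ψ' : StrongDual ℝ (lp (fun _ : ℕ => ℝ) 2) :=
    ψ.comp (J.symm.toContinuousLinearEquiv : lp (fun _ : ℕ => ℝ) 2 →L[ℝ] E.H (max 0 (-s)))
  let c := (InnerProductSpace.toDual ℝ (lp (fun _ : ℕ => ℝ) 2)).symm ψ'
  have h1 : ∀ v, ψ v = inner ℝ c (H.weighted E _ v) := by
    intro v
    rw [InnerProductSpace.toDual_symm_apply]
    change ψ v = ψ (J.symm (J v))
    rw [J.symm_apply_apply]
  have h2 : (fun n => E.lam n ^ (s / 2) * ψ (H.eig E _ n)) = c := by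
    funext n
    rw [h1, H.weighted_eig, lp.inner_single_right]
    change E.lam n ^ (s / 2) * (E.lam n ^ (max 0 (-s) / 2) * c n) = _
    rw [← mul_assoc, ← Real.rpow_add (E.lam_pos n), hr]
    ring_nf
    simp
  change Memℓp _ 2
  rw [h2]
  exact lp.memℓp c

/-- The pairing of matching coefficients is the `L²` inner product. -/
theorem HScale.toDual_eq_inner {E : DirichletEigenbasis Ω} {s : ℝ} {ψ : E.HScale s} {φ : E.H s}
    (h : ∀ n, φ.coeff n = ψ.coeff n) (v : E.H (max 0 (-s))) :
    HScale.toDual ψ v = inner ℝ (H.toL2 φ) (H.toL2 v) := by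
  have h1 := ψ.hasSum_coeff v
  have h2 := E.e.hasSum_inner_mul_inner (H.toL2 v) (H.toL2 φ)
  have h3 : (fun n => inner ℝ (H.toL2 v) (E.e n) * inner ℝ (E.e n) (H.toL2 φ)) =
      fun n => v.coeff n * ψ.coeff n := by
    funext n
    rw [← h n, real_inner_comm]
    rfl
  rw [h3] at h2
  rw [real_inner_comm]
  exact h1.unique h2

/-- For `s ≥ 0` every element of `ℍ^s` is given by a function `φ ∈ ℍ^s` of the same norm. -/
theorem HScale.exists_of_nonneg {E : DirichletEigenbasis Ω} {s : ℝ} (hs : 0 ≤ s)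
    (ψ : E.HScale s) : ∃ φ : E.H s, ‖φ‖ = ‖ψ‖ ∧ (∀ n, φ.coeff n = ψ.coeff n) ∧
      ∀ v, HScale.toDual ψ v = inner ℝ (H.toL2 φ) (H.toL2 v) := by
  obtain ⟨φ, hφ⟩ := H.weighted_surjective E hs (HScale.weighted E s ψ)
  have h : ∀ n, φ.coeff n = ψ.coeff n := fun n => by
    have h1 : E.lam n ^ (s / 2) * φ.coeff n = E.lam n ^ (s / 2) * ψ.coeff n := by
      rw [← H.weighted_apply, hφ, HScale.weighted_apply]
    exact mul_left_cancel₀ (E.lam_rpow_pos n _).ne' h1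
  refine ⟨φ, ?_, h, HScale.toDual_eq_inner h⟩
  rw [← H.norm_weighted, hφ, HScale.norm_weighted]

/-- Conversely every function `φ ∈ ℍ^s`, `s ≥ 0`, gives an element of `ℍ^s`. -/
theorem HScale.exists_coeff_eq {E : DirichletEigenbasis Ω} {s : ℝ} (φ : E.H s) :
    ∃ ψ : E.HScale s, ‖ψ‖ = ‖φ‖ ∧ (∀ n, ψ.coeff n = φ.coeff n) ∧
      ∀ v, HScale.toDual ψ v = inner ℝ (H.toL2 φ) (H.toL2 v) := by
  obtain ⟨ψ, hψ⟩ := HScale.weighted_surjective E s (H.weighted E s φ)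
  have h : ∀ n, φ.coeff n = ψ.coeff n := fun n => by
    have h1 : E.lam n ^ (s / 2) * ψ.coeff n = E.lam n ^ (s / 2) * φ.coeff n := by
      rw [← HScale.weighted_apply, hψ, H.weighted_apply]
    exact (mul_left_cancel₀ (E.lam_rpow_pos n _).ne' h1).symm
  refine ⟨ψ, ?_, fun n => (h n).symm, HScale.toDual_eq_inner h⟩
  rw [← H.norm_weighted, ← hψ, HScale.norm_weighted]

end DirichletEigenbasis

/-! ### The kernel, the relaxation function and the resolvent -/

/-- `s` is the continuous solution of `s(t) + θ ∫₀ᵗ a(t-τ) s(τ) dτ = 1`, `t ≥ 0`. -/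
def IsRelaxation (a : ℝ → ℝ) (θ : ℝ) (s : ℝ → ℝ) : Prop :=
  ContinuousOn s (Ici 0) ∧ ∀ t, 0 ≤ t → s t + θ * ∫ τ in (0 : ℝ)..t, a (t - τ) * s τ = 1

/-- `r ∈ L¹_loc` solves `r(t) + θ ∫₀ᵗ a(t-τ) r(τ) dτ = a(t)` for (almost every) `t > 0`. -/
def IsIntegralResolvent (a : ℝ → ℝ) (θ : ℝ) (r : ℝ → ℝ) : Prop :=
  LocallyIntegrableOn r (Ici 0) ∧
    ∀ᵐ t ∂volume.restrict (Ioi 0), r t + θ * ∫ τ in (0 : ℝ)..t, a (t - τ) * r τ = a t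

/-- `a ∈ L¹_loc` is completely positive: for every `θ > 0` the solutions `s` and `r` of the two
Volterra equations (they exist and are unique for every `a ∈ L¹_loc`) are nonnegative. -/
def CompletelyPositive (a : ℝ → ℝ) : Prop :=
  ∀ θ : ℝ, 0 < θ →
    (∃ s, IsRelaxation a θ s ∧ ∀ t, 0 ≤ t → 0 ≤ s t) ∧
    ∃ r, IsIntegralResolvent a θ r ∧ ∀ᵐ t ∂volume.restrict (Ioi 0), 0 ≤ r t

/-- The conditions on the memory kernel: `m ∈ L¹_loc(ℝ⁺)` is nonnegative and `1 + m` is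
completely positive. -/
structure IsMemoryKernel (m : ℝ → ℝ) : Prop where
  locallyIntegrable : LocallyIntegrableOn m (Ici 0)
  nonneg : ∀ᵐ t ∂volume.restrict (Ioi 0), 0 ≤ m t
  completelyPositive : CompletelyPositive fun t => 1 + m t

/-- The relaxation function `ω(t, θ)`: the solution of
`ω(t) + θ ∫₀ᵗ (1 + m(t-τ)) ω(τ) dτ = 1`, `t ≥ 0`. -/
def relaxation (m : ℝ → ℝ) (t θ : ℝ) : ℝ :=
  Classical.epsilon (IsRelaxation (fun t => 1 + m t) θ) t

variable {d : ℕ} {Ω : Set (EuclideanSpace ℝ (Fin d))}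

/-- The resolvent `S(t) c = ∑ ω(t, λ_n) c_n e_n`, with the series taken in `ℍ^μ`, as a function of
the coefficients `c_n`. -/
def resolvent (E : DirichletEigenbasis Ω) (m : ℝ → ℝ) (μ t : ℝ) (c : ℕ → ℝ) : E.H μ :=
  ∑' n, (relaxation m t (E.lam n) * c n) • DirichletEigenbasis.H.eig E μ n

/-- `(ℋ v)(t) = ∫₀ᵗ ℓ(t-τ) v(τ) dτ`. -/
def history {X : Type*} [NormedAddCommGroup X] [NormedSpace ℝ X] (l : ℝ → ℝ) (v : ℝ → X) (t : ℝ) :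
    X :=
  ∫ τ in (0 : ℝ)..t, l (t - τ) • v τ

/-- `u` satisfies `u(t) = S(t) ξ + ∫₀ᵗ S(t-τ) f(u(τ), ℋu(τ)) dτ` for `t ∈ [0,T]`, an identity
in `ℍ^μ`. -/
def IsMildSolution (E : DirichletEigenbasis Ω) (m l : ℝ → ℝ) (T μ s : ℝ)
    (f : E.H μ × E.H μ → E.HScale s) (ξ : E.H μ) (u : ℝ → E.H μ) : Prop :=
  ∀ t ∈ Icc 0 T, u t = resolvent E m μ t ξ.coeff +
    ∫ τ in (0 : ℝ)..t, resolvent E m μ (t - τ) (f (u τ, history l u τ)).coeff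

end RayleighStokes

end

/-!
Mild solutions are the fixed points of `u ↦ S(·) ξ + ∫₀ᵗ S(t-τ) f(u(τ), ℋu(τ)) dτ`, and the proof
is a contraction argument in `C([0,T]; ℍ^μ)`. The point is that `S(t)` maps `ℍ^{μ-1-δ}` to `ℍ^μ`
with norm at most `t^{-p}`, where `p = (1+δ)/2 < 1`, so that the kernel is integrable in time.

This smoothing bound says that `θ^p ω(t, θ) ≤ t^{-p}` for all `θ, t > 0`
(`IsMemoryKernel.rpow_mul_relaxation_le`), and it comes from complete positivity. By associativity
of causal convolution, `ω(t, θ) = 1 - θ ∫₀ᵗ r` with `r` the integral resolvent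
(`IsRelaxation.eq_one_sub`). Hence the relaxation function is unique, and as `r ≥ 0` it is
nonincreasing; it is nonnegative by assumption. As `1 + m ≥ 1`, the defining equation yields
`ω(t, θ) + θ t ω(t, θ) ≤ ω(t, θ) + θ ∫₀ᵗ ω ≤ 1`. Interpolation between `ω ≤ 1` and
`θ t ω ≤ 1` gives the bound. Continuity of `t ↦ S(t) v` follows from continuity of `ω(·, λ_n)` by
dominated convergence in `ℓ²` (`H.tendsto_of_coeff`). The growth of `λ_n` plays no role.

The fixed point argument (`existsUnique_volterra_fixedPoint`) is carried out for operator kernels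
`A` and `B` with integrable norm bounds, here `A = S` and `B = ℓ · id`. In the norm
`sup_t e^{-κt} ‖u(t)‖` the convolution with `A` is bounded by `∫₀ᵀ ‖A(σ)‖ e^{-κσ} dσ`, which tends
to `0` as `κ → ∞`. The solution map is therefore a contraction for large `κ`, whatever `T` and the
Lipschitz constants are.
-/

namespace RayleighStokes

open Filter Topology

/-! ### Causal convolutions of scalar functions -/

open ContinuousLinearMap in
/-- For functions cut off to `(0, t]`, the convolution over `ℝ` at a point `x ≤ t` is the causal
convolution over `(0, x)` of the original functions. -/
theorem convolution_indicator_Ioc (f g : ℝ → ℝ) {x t : ℝ} (hx : x ≤ t) :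
    convolution (indicator (Ioc 0 t) f) (indicator (Ioc 0 t) g) (mul ℝ ℝ) volume x =
      ∫ σ in Ioo 0 x, f σ * g (x - σ) := by
  rw [convolution_def, ← integral_indicator measurableSet_Ioo]
  congr 1
  funext σ
  simp only [mul_apply', indicator_apply, mem_Ioc, mem_Ioo]
  by_cases h1 : 0 < σ
  · by_cases h2 : σ < x
    · rw [if_pos ⟨h1, by linarith⟩, if_pos ⟨by linarith, by linarith⟩, if_pos ⟨h1, h2⟩]
    · rw [if_neg (fun h : 0 < x - σ ∧ x - σ ≤ t => h2 (by linarith [h.1])), mul_zero,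
        if_neg fun h => h2 h.2]
  · simp [h1]

open ContinuousLinearMap in
/-- Causal convolution is associative: `r * (a * s) = (r * a) * s`. The factor `s` is bounded, so
the identity holds at every point and not only almost everywhere. -/
theorem causalConvolution_assoc {r a s : ℝ → ℝ} {t : ℝ} (hr : IntegrableOn r (Ioc 0 t))
    (ha : IntegrableOn a (Ioc 0 t)) (hs : ContinuousOn s (Icc 0 t)) :
    ∫ τ in Ioo 0 t, (∫ σ in Ioo 0 τ, r σ * a (τ - σ)) * s (t - τ) =
      ∫ τ in Ioo 0 t, r τ * ∫ σ in Ioo 0 (t - τ), a σ * s (t - τ - σ) := by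
  have hr' := (integrable_indicator_iff measurableSet_Ioc).mpr hr
  have ha' := (integrable_indicator_iff measurableSet_Ioc).mpr ha
  have hs' : Integrable (indicator (Ioc 0 t) s) :=
    (integrable_indicator_iff measurableSet_Ioc).mpr
      ((hs.integrableOn_compact isCompact_Icc).mono_set Ioc_subset_Icc_self)
  obtain ⟨C, hC⟩ := isCompact_Icc.exists_bound_of_continuousOn hs
  have hC' : ∀ x, ‖indicator (Ioc 0 t) s x‖ ≤ max C 0 := by
    intro x
    by_cases hx : x ∈ Ioc 0 t
    · rw [indicator_of_mem hx]
      exact (hC x (Ioc_subset_Icc_self hx)).trans (le_max_left _ _)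
    · rw [indicator_of_notMem hx, norm_zero]
      exact le_max_right _ _
  set R := indicator (Ioc 0 t) r with hR
  set A := indicator (Ioc 0 t) a with hA
  set S := indicator (Ioc 0 t) s with hS
  -- a product of an integrable and a bounded function is integrable
  have hAS : ∀ x, ConvolutionExistsAt (fun x => ‖A x‖) (fun x => ‖S x‖) x (mul ℝ ℝ) volume := by
    intro x
    have h1 : AEStronglyMeasurable (fun y => S (x - y)) volume :=
      hs'.aestronglyMeasurable.comp_measurePreserving (Measure.measurePreserving_sub_left volume x)
    exact ha'.norm.mul_bdd h1.norm (c := max C 0) (ae_of_all _ fun y => by simpa using hC' (x - y))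
  have key := convolution_assoc (mul ℝ ℝ) (mul ℝ ℝ) (mul ℝ ℝ) (mul ℝ ℝ) (f := R) (g := A) (k := S)
    (x₀ := t) (μ := volume) (ν := volume) (fun x y z => by simp [mul_assoc])
    hr'.aestronglyMeasurable ha'.aestronglyMeasurable hs'.aestronglyMeasurable
    (hr'.ae_convolution_exists (mul ℝ ℝ) ha') (ae_of_all _ hAS) ?_
  · have e1 : convolution (convolution R A (mul ℝ ℝ) volume) S (mul ℝ ℝ) volume t =
        ∫ τ in Ioo 0 t, (∫ σ in Ioo 0 τ, r σ * a (τ - σ)) * s (t - τ) := by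
      rw [convolution_def, ← integral_indicator measurableSet_Ioo]
      congr 1
      funext τ
      by_cases h : τ ∈ Ioo 0 t
      · rw [indicator_of_mem h, mul_apply', hR, hA, convolution_indicator_Ioc _ _ h.2.le, hS,
          indicator_of_mem (show t - τ ∈ Ioc 0 t from ⟨by linarith [h.2], by linarith [h.1]⟩)]
      · rw [indicator_of_notMem h, mul_apply']
        rcases le_or_gt τ 0 with h0 | h0
        · rcases le_or_gt τ t with h1 | h1
          · rw [hR, hA, convolution_indicator_Ioc _ _ h1, Ioo_eq_empty (by linarith)]
            simp
          · rw [hS, indicator_of_notMem (fun h2 => by linarith [h2.1]), mul_zero]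
        · rw [hS, indicator_of_notMem (fun h2 => h ⟨h0, by linarith [h2.1]⟩), mul_zero]
    have e2 : convolution R (convolution A S (mul ℝ ℝ) volume) (mul ℝ ℝ) volume t =
        ∫ τ in Ioo 0 t, r τ * ∫ σ in Ioo 0 (t - τ), a σ * s (t - τ - σ) := by
      rw [convolution_def, ← integral_indicator measurableSet_Ioo]
      congr 1
      funext τ
      by_cases h : τ ∈ Ioo 0 t
      · rw [indicator_of_mem h, mul_apply', hA, hS, hR,
          convolution_indicator_Ioc _ _ (by linarith [h.1]),
          indicator_of_mem (Ioo_subset_Ioc_self h)]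
      · rw [indicator_of_notMem h, mul_apply']
        rcases le_or_gt τ 0 with h0 | h0
        · rw [hR, indicator_of_notMem (fun h2 => by linarith [h2.1]), zero_mul]
        · have h1 : t ≤ τ := by
            by_contra h1
            exact h ⟨h0, by linarith⟩
          rw [hA, hS, convolution_indicator_Ioc _ _ (by linarith), Ioo_eq_empty (by linarith)]
          simp
    rw [← e1, ← e2, key]
  · have h2 : Integrable (convolution (fun x => ‖A x‖) (fun x => ‖S x‖) (mul ℝ ℝ) volume) :=
      ha'.norm.integrable_convolution (mul ℝ ℝ) hs'.norm
    have h1 : AEStronglyMeasurable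
        (fun y => convolution (fun x => ‖A x‖) (fun x => ‖S x‖) (mul ℝ ℝ) volume (t - y)) volume :=
      h2.aestronglyMeasurable.comp_measurePreserving (Measure.measurePreserving_sub_left volume t)
    refine hr'.norm.mul_bdd h1 (c := (∫ y, ‖A y‖) * max C 0) (ae_of_all _ fun y => ?_)
    rw [convolution_def]
    refine (norm_integral_le_integral_norm _).trans ?_
    rw [← integral_mul_const]
    refine integral_mono_of_nonneg (ae_of_all _ fun z => norm_nonneg _)
      (ha'.norm.mul_const _) (ae_of_all _ fun z => ?_)
    simp only [mul_apply', norm_mul, norm_norm]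
    gcongr
    exact hC' _

/-- Reflecting the variable in a causal convolution. -/
theorem setIntegral_Ioo_mul_comp_sub (f g : ℝ → ℝ) {t : ℝ} (ht : 0 ≤ t) :
    ∫ τ in Ioo 0 t, f τ * g (t - τ) = ∫ τ in (0 : ℝ)..t, f (t - τ) * g τ := by
  rw [← integral_Ioc_eq_integral_Ioo, ← intervalIntegral.integral_of_le ht]
  simpa using intervalIntegral.integral_comp_sub_left (a := 0) (b := t)
    (fun τ => f (t - τ) * g τ) t

/-! ### The relaxation function -/

/-- The solution `s` of `s + θ a * s = 1` is `1 - θ ∫₀ᵗ r`, where `r` is the integral resolvent: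
convolving the equation for `s` with `r`, and that for `r` with `s`, gives
`1 * r = r * s + θ (r * a) * s = a * s`. In particular `s` is unique. -/
theorem IsRelaxation.eq_one_sub {a r s : ℝ → ℝ} {θ : ℝ}
    (ha : LocallyIntegrableOn a (Ici 0)) (hs : IsRelaxation a θ s)
    (hr : IsIntegralResolvent a θ r) {t : ℝ} (ht : 0 ≤ t) :
    s t = 1 - θ * ∫ τ in (0 : ℝ)..t, r τ := by
  have hsub : Icc 0 t ⊆ Ici (0 : ℝ) := Icc_subset_Ici_self
  have ha1 : IntegrableOn a (Icc 0 t) := ha.integrableOn_compact_subset hsub isCompact_Icc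
  have hr1 : IntegrableOn r (Icc 0 t) := hr.1.integrableOn_compact_subset hsub isCompact_Icc
  have hs1 : ContinuousOn s (Icc 0 t) := hs.1.mono hsub
  have hs2 : ContinuousOn (fun τ => s (t - τ)) (Icc 0 t) :=
    hs1.comp (by fun_prop) fun τ hτ => ⟨by linarith [hτ.2], by linarith [hτ.1]⟩
  have key := causalConvolution_assoc (hr1.mono_set Ioc_subset_Icc_self)
    (ha1.mono_set Ioc_subset_Icc_self) hs1
  have ir : IntegrableOn r (Ioo 0 t) := hr1.mono_set Ioo_subset_Icc_self
  have irs : IntegrableOn (fun τ => r τ * s (t - τ)) (Ioo 0 t) :=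
    (hr1.mul_continuousOn hs2 isCompact_Icc).mono_set Ioo_subset_Icc_self
  have ias : IntegrableOn (fun τ => a τ * s (t - τ)) (Ioo 0 t) :=
    (ha1.mul_continuousOn hs2 isCompact_Icc).mono_set Ioo_subset_Icc_self
  -- `θ (r * a) * s = a * s - r * s`
  have e1 : θ * ∫ τ in Ioo 0 t, (∫ σ in Ioo 0 τ, r σ * a (τ - σ)) * s (t - τ) =
      (∫ τ in Ioo 0 t, a τ * s (t - τ)) - ∫ τ in Ioo 0 t, r τ * s (t - τ) := by
    rw [← integral_sub ias irs, ← integral_const_mul]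
    refine integral_congr_ae ?_
    filter_upwards [ae_restrict_of_ae_restrict_of_subset Ioo_subset_Ioi_self hr.2,
      ae_restrict_mem measurableSet_Ioo] with τ h1 hτ
    have h2 : ∫ σ in Ioo 0 τ, r σ * a (τ - σ) = ∫ σ in (0 : ℝ)..τ, a (τ - σ) * r σ := by
      rw [← integral_Ioc_eq_integral_Ioo, ← intervalIntegral.integral_of_le hτ.1.le]
      simp only [mul_comm]
    rw [h2, ← h1]
    ring
  -- `θ r * (a * s) = 1 * r - r * s`
  have e2 : θ * ∫ τ in Ioo 0 t, r τ * ∫ σ in Ioo 0 (t - τ), a σ * s (t - τ - σ) =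
      (∫ τ in Ioo 0 t, r τ) - ∫ τ in Ioo 0 t, r τ * s (t - τ) := by
    rw [← integral_sub ir irs, ← integral_const_mul]
    refine setIntegral_congr_fun measurableSet_Ioo fun τ hτ => ?_
    have h0 : 0 ≤ t - τ := by linarith [hτ.2]
    have h1 := hs.2 (t - τ) h0
    rw [setIntegral_Ioo_mul_comp_sub a s h0]
    linear_combination r τ * h1
  have e3 := hs.2 t ht
  rw [← setIntegral_Ioo_mul_comp_sub a s ht] at e3
  rw [intervalIntegral.integral_of_le ht, integral_Ioc_eq_integral_Ioo]
  rw [key] at e1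
  linear_combination e3 + θ * e1 - θ * e2

/-- For a completely positive kernel the relaxation function is nonnegative and nonincreasing. -/
theorem CompletelyPositive.relaxation_props {a s : ℝ → ℝ} {θ : ℝ} (h : CompletelyPositive a)
    (ha : LocallyIntegrableOn a (Ici 0)) (hθ : 0 < θ) (hs : IsRelaxation a θ s) :
    (∀ t, 0 ≤ t → 0 ≤ s t) ∧ AntitoneOn s (Ici 0) := by
  obtain ⟨⟨s', hs', hpos⟩, r, hr, hr0⟩ := h θ hθ
  refine ⟨fun t ht => ?_, fun t ht t' ht' htt' => ?_⟩
  · rw [hs.eq_one_sub ha hr ht, ← hs'.eq_one_sub ha hr ht]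
    exact hpos t ht
  · rw [hs.eq_one_sub ha hr ht, hs.eq_one_sub ha hr ht']
    have hi : IntervalIntegrable r volume 0 t' := by
      rw [intervalIntegrable_iff_integrableOn_Icc_of_le ht']
      exact hr.1.integrableOn_compact_subset Icc_subset_Ici_self isCompact_Icc
    have := intervalIntegral.integral_mono_interval le_rfl ht htt'
      (ae_restrict_of_ae_restrict_of_subset Ioc_subset_Ioi_self hr0) hi
    gcongr

namespace IsMemoryKernel

variable {m : ℝ → ℝ} {θ t : ℝ}

theorem locallyIntegrableOn_one_add (hm : IsMemoryKernel m) :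
    LocallyIntegrableOn (fun t => 1 + m t) (Ici 0) :=
  ((continuous_const (y := (1 : ℝ))).locallyIntegrable.locallyIntegrableOn _).add
    hm.locallyIntegrable

/-- `ω(·, θ)` solves its defining equation. -/
theorem isRelaxation (hm : IsMemoryKernel m) (hθ : 0 < θ) :
    IsRelaxation (fun t => 1 + m t) θ fun t => relaxation m t θ :=
  Classical.epsilon_spec (p := IsRelaxation (fun t => 1 + m t) θ)
    ((hm.completelyPositive θ hθ).1.imp fun _ h => h.1)

theorem relaxation_nonneg (hm : IsMemoryKernel m) (hθ : 0 < θ) (ht : 0 ≤ t) :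
    0 ≤ relaxation m t θ :=
  (hm.completelyPositive.relaxation_props hm.locallyIntegrableOn_one_add hθ
    (hm.isRelaxation hθ)).1 t ht

theorem relaxation_antitoneOn (hm : IsMemoryKernel m) (hθ : 0 < θ) :
    AntitoneOn (fun t => relaxation m t θ) (Ici 0) :=
  (hm.completelyPositive.relaxation_props hm.locallyIntegrableOn_one_add hθ
    (hm.isRelaxation hθ)).2

theorem continuousOn_relaxation (hm : IsMemoryKernel m) (hθ : 0 < θ) :
    ContinuousOn (fun t => relaxation m t θ) (Ici 0) := (hm.isRelaxation hθ).1

/-- Since the kernel `1 + m` is at least `1` and `ω(·, θ)` is nonincreasing,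
`ω(t, θ) + θ t ω(t, θ) ≤ ω(t, θ) + θ ∫₀ᵗ ω ≤ 1`. -/
theorem relaxation_mul_le_one (hm : IsMemoryKernel m) (hθ : 0 < θ) (ht : 0 ≤ t) :
    relaxation m t θ + θ * (t * relaxation m t θ) ≤ 1 := by
  have heq : relaxation m t θ + θ * ∫ τ in (0 : ℝ)..t, (1 + m (t - τ)) * relaxation m τ θ = 1 :=
    (hm.isRelaxation hθ).2 t ht
  refine le_trans ?_ heq.le
  rw [← setIntegral_Ioo_mul_comp_sub (fun τ => 1 + m τ) _ ht]
  have hc : ContinuousOn (fun τ => relaxation m (t - τ) θ) (Icc 0 t) :=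
    (hm.continuousOn_relaxation hθ).comp (by fun_prop) fun τ hτ => by
      simpa using hτ.2
  have h1 : t * relaxation m t θ = ∫ _ in Ioo 0 t, relaxation m t θ := by
    simp [ht]
  have ha := (hm.locallyIntegrableOn_one_add.integrableOn_compact_subset
    (show Icc 0 t ⊆ Ici 0 from Icc_subset_Ici_self) isCompact_Icc).mul_continuousOn hc isCompact_Icc
  have h2 : ∫ _ in Ioo 0 t, relaxation m t θ ≤
      ∫ τ in Ioo 0 t, (1 + m τ) * relaxation m (t - τ) θ := by
    refine integral_mono_ae (by simp) (ha.mono_set Ioo_subset_Icc_self) ?_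
    filter_upwards [ae_restrict_of_ae_restrict_of_subset Ioo_subset_Ioi_self hm.nonneg,
      ae_restrict_mem measurableSet_Ioo] with τ h0 hτ
    have h3 : relaxation m t θ ≤ relaxation m (t - τ) θ :=
      hm.relaxation_antitoneOn hθ (show (0 : ℝ) ≤ t - τ by linarith [hτ.2]) ht
        (by linarith [hτ.1])
    have h4 := hm.relaxation_nonneg hθ ht
    have h5 : 0 ≤ m τ := h0
    nlinarith
  rw [h1]
  gcongr

theorem relaxation_le_one (hm : IsMemoryKernel m) (hθ : 0 < θ) (ht : 0 ≤ t) :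
    relaxation m t θ ≤ 1 := by
  have h1 := hm.relaxation_mul_le_one hθ ht
  have h2 := hm.relaxation_nonneg hθ ht
  have h3 : 0 ≤ θ * (t * relaxation m t θ) := by positivity
  linarith

/-- The smoothing estimate: interpolation between `ω ≤ 1` and `θ ω ≤ 1 / t`. -/
theorem rpow_mul_relaxation_le (hm : IsMemoryKernel m) (hθ : 0 < θ) (ht : 0 < t) {p : ℝ}
    (hp0 : 0 ≤ p) (hp1 : p ≤ 1) : θ ^ p * relaxation m t θ ≤ t ^ (-p) := by
  have h0 := hm.relaxation_nonneg hθ ht.le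
  have h1 := hm.relaxation_le_one hθ ht.le
  have h2 : θ * t * relaxation m t θ ≤ 1 := by
    have := hm.relaxation_mul_le_one hθ ht.le
    linarith
  have h3 : relaxation m t θ ≤ relaxation m t θ ^ p := by
    simpa using Real.rpow_le_rpow_of_exponent_ge' h0 h1 hp0 hp1
  have h4 : (θ * t * relaxation m t θ) ^ p ≤ 1 := Real.rpow_le_one (by positivity) h2 hp0
  rw [Real.mul_rpow (by positivity) h0, Real.mul_rpow hθ.le ht.le] at h4
  rw [Real.rpow_neg ht.le, ← one_div, le_div_iff₀ (Real.rpow_pos_of_pos ht p)]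
  have h5 : 0 < θ ^ p := Real.rpow_pos_of_pos hθ p
  have h6 : 0 < t ^ p := Real.rpow_pos_of_pos ht p
  calc θ ^ p * relaxation m t θ * t ^ p ≤ θ ^ p * relaxation m t θ ^ p * t ^ p := by gcongr
    _ ≤ 1 := by linarith

end IsMemoryKernel

/-! ### Abstract Volterra equations with operator kernels -/

section Volterra

variable {X Z : Type*} [NormedAddCommGroup X] [NormedSpace ℝ X] [NormedAddCommGroup Z]
  [NormedSpace ℝ Z]

/-- A family `A(σ)`, `0 < σ < T`, of bounded operators from `Z` to `X` whose norms are dominated by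
an integrable function `k`. Measurability is required in the form in which it is used, for the
action on continuous functions. -/
structure IsVolterraKernel (A : ℝ → Z →L[ℝ] X) (k : ℝ → ℝ) (T : ℝ) : Prop where
  integrableOn : IntegrableOn k (Ioo 0 T)
  bound : ∀ σ ∈ Ioo 0 T, ‖A σ‖ ≤ k σ
  aestronglyMeasurable : ∀ v : ℝ → Z, Continuous v →
    AEStronglyMeasurable (fun σ => A σ (v σ)) (volume.restrict (Ioo 0 T))

/-- The Volterra operator `u ↦ ∫₀ᵗ A(t-τ) u(τ) dτ`. -/
noncomputable def volterra (A : ℝ → Z →L[ℝ] X) (u : ℝ → Z) (t : ℝ) : X :=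
  ∫ τ in (0 : ℝ)..t, A (t - τ) (u τ)

theorem volterra_eq_setIntegral (A : ℝ → Z →L[ℝ] X) (u : ℝ → Z) {t : ℝ} (ht : 0 ≤ t) :
    volterra A u t = ∫ σ in Ioo 0 t, A σ (u (t - σ)) := by
  rw [← integral_Ioc_eq_integral_Ioo, ← intervalIntegral.integral_of_le ht]
  have h := intervalIntegral.integral_comp_sub_left (a := 0) (b := t)
    (fun τ => A (t - τ) (u τ)) t
  simp only [sub_sub_cancel, sub_self, sub_zero] at h
  exact h.symm

namespace IsVolterraKernel

variable {A : ℝ → Z →L[ℝ] X} {k : ℝ → ℝ} {T t : ℝ} {u v : ℝ → Z}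

theorem nonneg (hA : IsVolterraKernel A k T) {σ : ℝ} (hσ : σ ∈ Ioo 0 T) : 0 ≤ k σ :=
  (norm_nonneg _).trans (hA.bound σ hσ)

theorem aestronglyMeasurable_comp_sub (hA : IsVolterraKernel A k T)
    (hu : ContinuousOn u (Icc 0 T)) (ht : t ∈ Icc 0 T) :
    AEStronglyMeasurable (fun σ => A σ (u (t - σ))) (volume.restrict (Ioo 0 t)) := by
  have hT : 0 ≤ T := ht.1.trans ht.2
  have hc : Continuous fun σ : ℝ => u (projIcc 0 T hT (t - σ)) :=
    (hu.comp_continuous (continuous_subtype_val.comp continuous_projIcc)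
      (fun x => (projIcc 0 T hT x).2)).comp (by fun_prop : Continuous fun σ : ℝ => t - σ)
  refine ((hA.aestronglyMeasurable _ hc).mono_measure
    (Measure.restrict_mono (Ioo_subset_Ioo_right ht.2) le_rfl)).congr ?_
  filter_upwards [ae_restrict_mem measurableSet_Ioo] with σ hσ
  rw [projIcc_of_mem hT ⟨by linarith [hσ.2], by linarith [hσ.1, ht.2]⟩]

theorem integrableOn_comp_sub (hA : IsVolterraKernel A k T)
    (hu : ContinuousOn u (Icc 0 T)) (ht : t ∈ Icc 0 T) :
    IntegrableOn (fun σ => A σ (u (t - σ))) (Ioo 0 t) := by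
  obtain ⟨M, hM⟩ := isCompact_Icc.exists_bound_of_continuousOn hu
  have hk := (hA.integrableOn.mono_set (Ioo_subset_Ioo_right ht.2)).mul_const M
  refine hk.mono' (hA.aestronglyMeasurable_comp_sub hu ht) ?_
  filter_upwards [ae_restrict_mem measurableSet_Ioo] with σ hσ
  have hσ' : σ ∈ Ioo 0 T := ⟨hσ.1, hσ.2.trans_le ht.2⟩
  exact ContinuousLinearMap.le_of_opNorm_le_of_le _ (hA.bound σ hσ')
    (hM _ ⟨by linarith [hσ.2], by linarith [hσ.1, ht.2]⟩)

theorem volterra_sub (hA : IsVolterraKernel A k T) (hu : ContinuousOn u (Icc 0 T))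
    (hv : ContinuousOn v (Icc 0 T)) (ht : t ∈ Icc 0 T) :
    volterra A (fun τ => u τ - v τ) t = volterra A u t - volterra A v t := by
  simp only [volterra_eq_setIntegral _ _ ht.1, map_sub]
  exact integral_sub (hA.integrableOn_comp_sub hu ht) (hA.integrableOn_comp_sub hv ht)

/-- The Volterra operator maps continuous functions to continuous functions. -/
theorem continuousOn_volterra (hA : IsVolterraKernel A k T) (hu : ContinuousOn u (Icc 0 T)) :
    ContinuousOn (volterra A u) (Icc 0 T) := by
  obtain ⟨M, hM⟩ := isCompact_Icc.exists_bound_of_continuousOn hu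
  let F : ℝ → ℝ → X := fun t => indicator (Ioo 0 t) fun σ => A σ (u (t - σ))
  have hF : ∀ t ∈ Icc 0 T, volterra A u t = ∫ σ in Ioo 0 T, F t σ := by
    intro t ht
    rw [volterra_eq_setIntegral _ _ ht.1, setIntegral_indicator measurableSet_Ioo,
      inter_eq_self_of_subset_right (Ioo_subset_Ioo_right ht.2)]
  refine ContinuousOn.congr (f := fun t => ∫ σ in Ioo 0 T, F t σ) (fun t₀ ht₀ => ?_) hF
  refine continuousWithinAt_of_dominated (bound := fun σ => k σ * M) ?_ ?_
    (hA.integrableOn.mul_const M) ?_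
  · filter_upwards [self_mem_nhdsWithin] with t ht
    refine (aestronglyMeasurable_indicator_iff measurableSet_Ioo).mpr ?_
    refine (hA.aestronglyMeasurable_comp_sub hu ht).mono_measure ?_
    exact Measure.restrict_mono_measure Measure.restrict_le_self _
  · filter_upwards [self_mem_nhdsWithin] with t ht
    filter_upwards [ae_restrict_mem measurableSet_Ioo] with σ hσ
    by_cases h : σ ∈ Ioo 0 t
    · simp only [F, indicator_of_mem h]
      exact ContinuousLinearMap.le_of_opNorm_le_of_le _ (hA.bound σ hσ)
        (hM _ ⟨by linarith [h.2], by linarith [h.1, ht.2]⟩)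
    · simp only [F, indicator_of_notMem h, norm_zero]
      exact mul_nonneg (hA.nonneg hσ) ((norm_nonneg _).trans (hM t ht))
  · -- the integrand can only jump in `t` at `t = σ`
    have hne : ∀ᵐ σ ∂volume.restrict (Ioo 0 T), σ ≠ t₀ :=
      ae_restrict_of_ae (Measure.ae_ne volume t₀)
    filter_upwards [hne, ae_restrict_mem measurableSet_Ioo] with σ hσ hσT
    rcases hσ.lt_or_gt with h | h
    · have hev : ∀ᶠ t in 𝓝[Icc 0 T] t₀, F t σ = A σ (u (t - σ)) := by
        filter_upwards [mem_nhdsWithin_of_mem_nhds (Ioi_mem_nhds h)] with t ht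
        exact indicator_of_mem (show σ ∈ Ioo 0 t from ⟨hσT.1, ht⟩) _
      have hmem : t₀ - σ ∈ Ioo 0 T := ⟨by linarith, by linarith [hσT.1, ht₀.2]⟩
      have hcu : ContinuousAt (fun t => u (t - σ)) t₀ :=
        ContinuousAt.comp' (f := fun t => t - σ) (hu.continuousAt (Icc_mem_nhds hmem.1 hmem.2))
          (by fun_prop)
      exact (((A σ).continuous.continuousAt.comp' hcu).continuousWithinAt).congr_of_eventuallyEq
        hev (indicator_of_mem (show σ ∈ Ioo 0 t₀ from ⟨hσT.1, h⟩) _)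
    · have hev : ∀ᶠ t in 𝓝[Icc 0 T] t₀, F t σ = 0 := by
        filter_upwards [mem_nhdsWithin_of_mem_nhds (Iio_mem_nhds h)] with t ht
        exact indicator_of_notMem (fun h' => lt_asymm h'.2 ht) _
      exact continuousWithinAt_const.congr_of_eventuallyEq hev
        (indicator_of_notMem (fun h' => lt_asymm h'.2 h) _)

theorem integrableOn_mul_exp (hA : IsVolterraKernel A k T) (κ : ℝ) :
    IntegrableOn (fun σ => k σ * Real.exp (-(κ * σ))) (Ioo 0 T) := by
  have h : IntegrableOn (fun σ => k σ * Real.exp (-(κ * σ))) (Icc 0 T) := by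
    refine IntegrableOn.mul_continuousOn ?_ (by fun_prop) isCompact_Icc
    rw [integrableOn_Icc_iff_integrableOn_Ioo]
    exact hA.integrableOn
  exact h.mono_set Ioo_subset_Icc_self

/-- The Volterra operator in the norm with weight `e^{-κt}`. -/
theorem norm_volterra_le (hA : IsVolterraKernel A k T) {κ M : ℝ} (hM : 0 ≤ M)
    (hu : ∀ τ ∈ Icc 0 T, ‖u τ‖ ≤ M * Real.exp (κ * τ)) (ht : t ∈ Icc 0 T) :
    ‖volterra A u t‖ ≤
      (∫ σ in Ioo 0 T, k σ * Real.exp (-(κ * σ))) * M * Real.exp (κ * t) := by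
  have hi := ((hA.integrableOn_mul_exp κ).mul_const M).mul_const (Real.exp (κ * t))
  rw [volterra_eq_setIntegral _ _ ht.1, ← integral_mul_const, ← integral_mul_const]
  refine (norm_integral_le_of_norm_le (hi.mono_measure
    (Measure.restrict_mono (Ioo_subset_Ioo_right ht.2) le_rfl)) ?_).trans
    (setIntegral_mono_set hi ?_ (Ioo_subset_Ioo_right ht.2).eventuallyLE)
  · filter_upwards [ae_restrict_mem measurableSet_Ioo] with σ hσ
    have h1 := ContinuousLinearMap.le_of_opNorm_le_of_le _
      (hA.bound σ ⟨hσ.1, hσ.2.trans_le ht.2⟩)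
      (hu (t - σ) ⟨by linarith [hσ.2], by linarith [hσ.1, ht.2]⟩)
    refine h1.trans_eq ?_
    have h2 : Real.exp (κ * (t - σ)) = Real.exp (-(κ * σ)) * Real.exp (κ * t) := by
      rw [← Real.exp_add]
      ring_nf
    rw [h2]
    ring
  · filter_upwards [ae_restrict_mem measurableSet_Ioo] with σ hσ
    have := hA.nonneg hσ
    simp only [Pi.zero_apply]
    positivity

/-- The norm of the Volterra operator becomes small in the weighted norms. -/
theorem tendsto_integral_mul_exp (hA : IsVolterraKernel A k T) :
    Tendsto (fun κ : ℝ => ∫ σ in Ioo 0 T, k σ * Real.exp (-(κ * σ))) atTop (𝓝 0) := by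
  have h := tendsto_integral_filter_of_dominated_convergence (l := (atTop : Filter ℝ))
    (μ := volume.restrict (Ioo 0 T)) (F := fun κ σ => k σ * Real.exp (-(κ * σ)))
    (f := fun _ => 0) k
    (Eventually.of_forall fun κ => (hA.integrableOn_mul_exp κ).aestronglyMeasurable) ?_
    hA.integrableOn ?_
  · simpa using h
  · filter_upwards [eventually_ge_atTop 0] with κ hκ
    filter_upwards [ae_restrict_mem measurableSet_Ioo] with σ hσ
    have h0 := hA.nonneg hσ
    rw [Real.norm_of_nonneg (by positivity)]
    exact mul_le_of_le_one_right h0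
      (Real.exp_le_one_iff.mpr (neg_nonpos.mpr (mul_nonneg hκ hσ.1.le)))
  · filter_upwards [ae_restrict_mem measurableSet_Ioo] with σ hσ
    have h1 : Tendsto (fun κ : ℝ => Real.exp (-(κ * σ))) atTop (𝓝 0) :=
      Real.tendsto_exp_neg_atTop_nhds_zero.comp (tendsto_id.atTop_mul_const hσ.1)
    simpa using h1.const_mul (k σ)

end IsVolterraKernel

/-- Multiplication by `e^{κt}` on `C([0,T]; X)`. It carries the supremum norm to a weighted
norm for which the solution map of a Volterra equation is a contraction. -/
noncomputable def expWeight (T κ : ℝ) : C(Icc (0 : ℝ) T, X) ≃ C(Icc (0 : ℝ) T, X) where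
  toFun u := ⟨fun t => Real.exp (κ * t) • u t, by fun_prop⟩
  invFun u := ⟨fun t => Real.exp (-(κ * t)) • u t, by fun_prop⟩
  left_inv u := by
    ext t
    simp [smul_smul, ← Real.exp_add]
  right_inv u := by
    ext t
    simp [smul_smul, ← Real.exp_add]

/-- Global well-posedness of the semilinear Volterra equation
`u = x₀ + A * f(u, B * u)` in `C([0,T]; X)` for Lipschitz continuous `f`. There is no smallness
condition on `T`: in the norm with weight `e^{-κt}`, `κ` large, the solution map is a
contraction. -/
theorem existsUnique_volterra_fixedPoint [CompleteSpace X] {A : ℝ → Z →L[ℝ] X}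
    {B : ℝ → X →L[ℝ] X} {kA kB : ℝ → ℝ} {T : ℝ} (hT : 0 ≤ T) (hA : IsVolterraKernel A kA T)
    (hB : IsVolterraKernel B kB T) {f : X × X → Z} (hf : Continuous f) {L K : ℝ}
    (hL : 0 ≤ L) (hK : 0 ≤ K)
    (hLip : ∀ v₁ v₂ w₁ w₂ : X, ‖f (v₁, w₁) - f (v₂, w₂)‖ ≤ L * ‖v₁ - v₂‖ + K * ‖w₁ - w₂‖)
    {x₀ : ℝ → X} (hx₀ : ContinuousOn x₀ (Icc 0 T)) :
    ∃! u : C(Icc (0 : ℝ) T, X), ∀ t ∈ Icc 0 T, IccExtend hT u t = x₀ t +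
      volterra A (fun τ => f (IccExtend hT u τ, volterra B (IccExtend hT u) τ)) t := by
  let G : C(Icc (0 : ℝ) T, X) → ℝ → Z :=
    fun u τ => f (IccExtend hT u τ, volterra B (IccExtend hT u) τ)
  have hext : ∀ u : C(Icc (0 : ℝ) T, X), ContinuousOn (IccExtend hT u) (Icc 0 T) :=
    fun u => u.continuous.Icc_extend'.continuousOn
  have hG : ∀ u, ContinuousOn (G u) (Icc 0 T) := fun u =>
    hf.comp_continuousOn ((hext u).prodMk (hB.continuousOn_volterra (hext u)))
  -- the solution map
  let Φ : C(Icc (0 : ℝ) T, X) → C(Icc (0 : ℝ) T, X) := fun u =>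
    ⟨fun t => x₀ t + volterra A (G u) t,
      (hx₀.add (hA.continuousOn_volterra (hG u))).domRestrict⟩
  have hsol : ∀ u : C(Icc (0 : ℝ) T, X),
      (∀ t ∈ Icc 0 T, IccExtend hT u t = x₀ t + volterra A (G u) t) ↔ Φ u = u := by
    intro u
    constructor
    · intro h
      ext t
      have h1 := h t t.2
      rw [IccExtend_val] at h1
      exact h1.symm
    · intro h t ht
      have h1 := congrArg (fun w : C(Icc (0 : ℝ) T, X) => w ⟨t, ht⟩) h
      rw [IccExtend_of_mem _ _ ht]
      exact h1.symm
  let I : (ℝ → ℝ) → ℝ → ℝ := fun k κ => ∫ σ in Ioo 0 T, k σ * Real.exp (-(κ * σ))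
  obtain ⟨κ, hκ⟩ : ∃ κ, I kA κ * (L + K * I kB κ) ≤ 1 / 2 := by
    have h := hA.tendsto_integral_mul_exp.mul
      ((hB.tendsto_integral_mul_exp.const_mul K).const_add L)
    rw [zero_mul] at h
    exact (h.eventually_le_const (by norm_num : (0 : ℝ) < 1 / 2)).exists
  have hIB : 0 ≤ I kB κ := setIntegral_nonneg measurableSet_Ioo fun σ hσ =>
    mul_nonneg (hB.nonneg hσ) (Real.exp_pos _).le
  let W : C(Icc (0 : ℝ) T, X) ≃ C(Icc (0 : ℝ) T, X) := expWeight T κ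
  have hcontr : ContractingWith (1 / 2) fun u => W.symm (Φ (W u)) := by
    refine ⟨by norm_num, LipschitzWith.of_dist_le_mul fun v w => ?_⟩
    have hd : 0 ≤ dist v w := dist_nonneg
    rw [ContinuousMap.dist_le (by positivity)]
    rintro ⟨t, ht⟩
    have h1 : ∀ τ ∈ Icc 0 T, ‖IccExtend hT (W v) τ - IccExtend hT (W w) τ‖ ≤
        dist v w * Real.exp (κ * τ) := by
      intro τ hτ
      rw [IccExtend_of_mem _ _ hτ, IccExtend_of_mem _ _ hτ]
      change ‖Real.exp (κ * τ) • v ⟨τ, hτ⟩ - Real.exp (κ * τ) • w ⟨τ, hτ⟩‖ ≤ _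
      rw [← smul_sub, norm_smul, Real.norm_of_nonneg (Real.exp_pos _).le, mul_comm,
        ← dist_eq_norm]
      gcongr
      exact ContinuousMap.dist_apply_le_dist _
    have h2 : ∀ τ ∈ Icc 0 T, ‖G (W v) τ - G (W w) τ‖ ≤
        ((L + K * I kB κ) * dist v w) * Real.exp (κ * τ) := by
      intro τ hτ
      refine (hLip _ _ _ _).trans ?_
      rw [← hB.volterra_sub (hext _) (hext _) hτ]
      have h3 := hB.norm_volterra_le hd h1 hτ
      have h4 := h1 τ hτ
      calc _ ≤ L * (dist v w * Real.exp (κ * τ)) +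
            K * (I kB κ * dist v w * Real.exp (κ * τ)) := by gcongr
        _ = _ := by ring
    have h5 := hA.norm_volterra_le (by positivity) h2 ht
    rw [hA.volterra_sub (hG _) (hG _) ht] at h5
    rw [dist_eq_norm]
    change ‖Real.exp (-(κ * t)) • (x₀ t + volterra A (G (W v)) t) -
      Real.exp (-(κ * t)) • (x₀ t + volterra A (G (W w)) t)‖ ≤ _
    rw [← smul_sub, add_sub_add_left_eq_sub, norm_smul, Real.norm_of_nonneg (Real.exp_pos _).le]
    calc _ ≤ Real.exp (-(κ * t)) *
          (I kA κ * ((L + K * I kB κ) * dist v w) * Real.exp (κ * t)) := by gcongr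
      _ = (I kA κ * (L + K * I kB κ)) * dist v w * (Real.exp (-(κ * t)) * Real.exp (κ * t)) := by
        ring
      _ = (I kA κ * (L + K * I kB κ)) * dist v w := by
        rw [← Real.exp_add, neg_add_cancel, Real.exp_zero, mul_one]
      _ ≤ _ := by
        push_cast
        gcongr
  refine ⟨W (hcontr.fixedPoint _), (hsol _).mpr ?_, fun u hu => ?_⟩
  · exact (W.symm_apply_eq).mp hcontr.fixedPoint_isFixedPt
  · refine (W.symm_apply_eq).mp (hcontr.fixedPoint_unique ?_)
    change W.symm (Φ (W (W.symm u))) = W.symm u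
    rw [W.apply_symm_apply, (hsol u).mp hu]

end Volterra

namespace DirichletEigenbasis

variable {d : ℕ} {Ω : Set (EuclideanSpace ℝ (Fin d))} {E : DirichletEigenbasis Ω} {μ s : ℝ}

/-! ### Coefficients and norms in the spaces `ℍ^ρ` -/

theorem H.coeff_add (φ ψ : E.H μ) (n : ℕ) : (φ + ψ).coeff n = φ.coeff n + ψ.coeff n := by
  simp only [H.coeff, map_add, inner_add_right]

theorem H.coeff_sub (φ ψ : E.H μ) (n : ℕ) : (φ - ψ).coeff n = φ.coeff n - ψ.coeff n := by
  simp only [H.coeff, map_sub, inner_sub_right]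

theorem H.coeff_smul (c : ℝ) (φ : E.H μ) (n : ℕ) : (c • φ).coeff n = c * φ.coeff n := by
  simp only [H.coeff, map_smul, inner_smul_right]

theorem HScale.coeff_add (φ ψ : E.HScale s) (n : ℕ) :
    (φ + ψ).coeff n = φ.coeff n + ψ.coeff n := by
  simp only [HScale.coeff, map_add, _root_.add_apply]

theorem HScale.coeff_smul (c : ℝ) (φ : E.HScale s) (n : ℕ) :
    (c • φ).coeff n = c * φ.coeff n := by
  simp only [HScale.coeff, map_smul, _root_.smul_apply, smul_eq_mul]

/-- The series `∑ cₙ eₙ` converges in `ℍ^μ` and has the coefficients `cₙ`, as soon as the weighted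
coefficients are square summable. -/
theorem H.coeff_tsum_eig (hμ : 0 ≤ μ) {c : ℕ → ℝ}
    (hc : Memℓp (fun n => E.lam n ^ (μ / 2) * c n) 2) (n : ℕ) :
    (∑' k, c k • H.eig E μ k).coeff n = c n := by
  obtain ⟨φ, hφ⟩ := H.weighted_surjective E hμ ⟨_, hc⟩
  have h : ∀ n, φ.coeff n = c n := fun n => by
    have h1 : E.lam n ^ (μ / 2) * φ.coeff n = E.lam n ^ (μ / 2) * c n := by
      rw [← H.weighted_apply, hφ]
    exact mul_left_cancel₀ (E.lam_rpow_pos n _).ne' h1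
  have h2 := H.hasSum_eig φ
  simp only [h] at h2
  rw [h2.tsum_eq, h]

theorem memlp_of_norm_le_mul {x : lp (fun _ : ℕ => ℝ) 2} {y : ℕ → ℝ} {C : ℝ}
    (h : ∀ n, ‖y n‖ ≤ C * ‖x n‖) : Memℓp y 2 := by
  have hx : Memℓp (C • (x : ℕ → ℝ)) 2 := (lp.memℓp x).const_smul C
  refine memℓp_gen ((hx.summable (by norm_num)).of_nonneg_of_le (fun n => by positivity) ?_)
  intro n
  gcongr
  refine (h n).trans ?_
  rw [Pi.smul_apply, norm_smul]
  gcongr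
  exact Real.le_norm_self C

theorem H.norm_le_of_coeff {φ : E.H μ} {x : lp (fun _ : ℕ => ℝ) 2} {C : ℝ} (hC : 0 ≤ C)
    (h : ∀ n, ‖E.lam n ^ (μ / 2) * φ.coeff n‖ ≤ C * ‖x n‖) : ‖φ‖ ≤ C * ‖x‖ := by
  rw [← H.norm_weighted]
  refine lp.norm_le_of_forall_sum_le (by norm_num) (by positivity) fun t => ?_
  have hx := lp.sum_rpow_le_norm_rpow (p := 2) (by norm_num) x t
  simp only [ENNReal.toReal_ofNat, Real.rpow_ofNat] at hx ⊢
  calc ∑ n ∈ t, ‖H.weighted E μ φ n‖ ^ 2 ≤ ∑ n ∈ t, (C * ‖x n‖) ^ 2 := by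
        gcongr with n
        exact h n
    _ = C ^ 2 * ∑ n ∈ t, ‖x n‖ ^ 2 := by simp only [mul_pow, Finset.mul_sum]
    _ ≤ C ^ 2 * ‖x‖ ^ 2 := by gcongr
    _ = (C * ‖x‖) ^ 2 := by ring

/-- Dominated convergence in `ℍ^μ`: convergence of every coefficient, under a common square
summable bound, gives convergence in norm. -/
theorem H.tendsto_of_coeff {ι : Type*} {l : Filter ι} {φ : ι → E.H μ} {φ₀ : E.H μ}
    {x : lp (fun _ : ℕ => ℝ) 2} {C : ℝ}
    (hb : ∀ᶠ i in l, ∀ n, ‖E.lam n ^ (μ / 2) * (φ i).coeff n‖ ≤ C * ‖x n‖)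
    (hb₀ : ∀ n, ‖E.lam n ^ (μ / 2) * φ₀.coeff n‖ ≤ C * ‖x n‖)
    (hc : ∀ n, Tendsto (fun i => (φ i).coeff n) l (𝓝 (φ₀.coeff n))) :
    Tendsto φ l (𝓝 φ₀) := by
  rw [tendsto_iff_norm_sub_tendsto_zero]
  have hx : Summable fun n => (2 * (C * ‖x n‖)) ^ 2 := by
    have h1 := (lp.memℓp x).summable (by norm_num)
    norm_num at h1
    refine (h1.mul_left (4 * C ^ 2)).congr fun n => ?_
    simp only [Real.norm_eq_abs, mul_pow, sq_abs]
    ring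
  have key : Tendsto (fun i => ∑' n, |E.lam n ^ (μ / 2) * (φ i - φ₀).coeff n| ^ 2) l
      (𝓝 (∑' _ : ℕ, (0 : ℝ))) := by
    refine tendsto_tsum_of_dominated_convergence hx (fun n => ?_) ?_
    · have h1 : Tendsto (fun i => |E.lam n ^ (μ / 2) * (φ i - φ₀).coeff n| ^ 2) l
          (𝓝 (|E.lam n ^ (μ / 2) * (φ₀.coeff n - φ₀.coeff n)| ^ 2)) := by
        simp only [H.coeff_sub]
        exact ((((hc n).sub_const _).const_mul _).abs).pow 2
      simpa using h1
    · filter_upwards [hb] with i hi n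
      rw [norm_pow, norm_abs_eq_norm, H.coeff_sub, mul_sub, two_mul]
      gcongr
      exact (norm_sub_le _ _).trans (add_le_add (hi n) (hb₀ n))
  simp only [← H.norm_sq, tsum_zero] at key
  have h2 := key.sqrt
  simpa using h2

end DirichletEigenbasis

open DirichletEigenbasis

/-! ### The resolvent family -/

section Resolvent

variable {d : ℕ} {Ω : Set (EuclideanSpace ℝ (Fin d))} {E : DirichletEigenbasis Ω} {m : ℝ → ℝ}
  {μ p t C : ℝ} {c : ℕ → ℝ} {x : lp (fun _ : ℕ => ℝ) 2}

/-- The weight `λ^{μ/2}` is split into `λ^p`, absorbed by the relaxation function, and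
`λ^{μ/2-p}`, carried by the coefficients. -/
theorem IsMemoryKernel.norm_weight_mul_relaxation_le (hm : IsMemoryKernel m) (ht : 0 ≤ t)
    (hC : ∀ n, E.lam n ^ p * relaxation m t (E.lam n) ≤ C)
    (hx : ∀ n, E.lam n ^ (μ / 2 - p) * c n = x n) (n : ℕ) :
    ‖E.lam n ^ (μ / 2) * (relaxation m t (E.lam n) * c n)‖ ≤ C * ‖x n‖ := by
  have h0 := hm.relaxation_nonneg (E.lam_pos n) ht
  have h1 : E.lam n ^ (μ / 2) * (relaxation m t (E.lam n) * c n) =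
      E.lam n ^ p * relaxation m t (E.lam n) * x n := by
    rw [← hx n, show μ / 2 = p + (μ / 2 - p) by ring, Real.rpow_add (E.lam_pos n)]
    ring_nf
  rw [h1, norm_mul, Real.norm_of_nonneg (mul_nonneg (E.lam_rpow_pos n p).le h0)]
  gcongr
  exact hC n

theorem IsMemoryKernel.coeff_resolvent (hm : IsMemoryKernel m) (hμ : 0 ≤ μ) (ht : 0 ≤ t)
    (hC : ∀ n, E.lam n ^ p * relaxation m t (E.lam n) ≤ C)
    (hx : ∀ n, E.lam n ^ (μ / 2 - p) * c n = x n) (n : ℕ) :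
    (resolvent E m μ t c).coeff n = relaxation m t (E.lam n) * c n :=
  H.coeff_tsum_eig (c := fun n => relaxation m t (E.lam n) * c n) hμ
    (memlp_of_norm_le_mul (hm.norm_weight_mul_relaxation_le ht hC hx)) n

/-- Strong continuity of the resolvent family on a set of times where `λ^p ω(·, λ)` is bounded
uniformly in `λ`. -/
theorem IsMemoryKernel.continuousOn_resolvent (hm : IsMemoryKernel m) (hμ : 0 ≤ μ) {J : Set ℝ}
    (hJ : J ⊆ Ici 0) (hC : ∀ t ∈ J, ∀ n, E.lam n ^ p * relaxation m t (E.lam n) ≤ C)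
    (hx : ∀ n, E.lam n ^ (μ / 2 - p) * c n = x n) :
    ContinuousOn (fun t => resolvent E m μ t c) J := by
  intro t₀ ht₀
  have hcoeff : ∀ t ∈ J, ∀ n, (resolvent E m μ t c).coeff n = relaxation m t (E.lam n) * c n :=
    fun t ht => hm.coeff_resolvent hμ (hJ ht) (hC t ht) hx
  have hbound : ∀ t ∈ J, ∀ n,
      ‖E.lam n ^ (μ / 2) * (resolvent E m μ t c).coeff n‖ ≤ C * ‖x n‖ := by
    intro t ht n
    rw [hcoeff t ht n]
    exact hm.norm_weight_mul_relaxation_le (hJ ht) (hC t ht) hx n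
  refine H.tendsto_of_coeff (x := x) (C := C) ?_ (hbound t₀ ht₀) fun n => ?_
  · filter_upwards [self_mem_nhdsWithin] with t ht using hbound t ht
  · have h1 : ContinuousWithinAt (fun t => relaxation m t (E.lam n) * c n) J t₀ :=
      (((hm.continuousOn_relaxation (E.lam_pos n)).mono hJ).mul_const (c n)) t₀ ht₀
    rw [hcoeff t₀ ht₀ n]
    refine h1.congr' ?_
    filter_upwards [self_mem_nhdsWithin] with t ht using (hcoeff t ht n).symm

/-- For `t > 0` the resolvent `S(t)` is a bounded operator from `ℍ^{μ-2p}` to `ℍ^μ` of norm at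
most `t^{-p}`. -/
theorem IsMemoryKernel.exists_resolventCLM (hm : IsMemoryKernel m) (hμ : 0 ≤ μ) (hp0 : 0 ≤ p)
    (hp1 : p ≤ 1) {s : ℝ} (hs : s = μ - 2 * p) :
    ∃ A : ℝ → E.HScale s →L[ℝ] E.H μ, ∀ t, 0 < t →
      (∀ ψ, A t ψ = resolvent E m μ t ψ.coeff) ∧ ‖A t‖ ≤ t ^ (-p) := by
  have hx : ∀ (ψ : E.HScale s) (n : ℕ),
      E.lam n ^ (μ / 2 - p) * ψ.coeff n = HScale.weighted E s ψ n := by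
    intro ψ n
    rw [HScale.weighted_apply, show s / 2 = μ / 2 - p by rw [hs]; ring]
  suffices h : ∀ t : ℝ, ∃ A : E.HScale s →L[ℝ] E.H μ, 0 < t →
      (∀ ψ, A ψ = resolvent E m μ t ψ.coeff) ∧ ‖A‖ ≤ t ^ (-p) by
    choose A hA using h
    exact ⟨A, hA⟩
  intro t
  by_cases ht : 0 < t
  swap
  · exact ⟨0, fun h => absurd h ht⟩
  have hC : ∀ n, E.lam n ^ p * relaxation m t (E.lam n) ≤ t ^ (-p) :=
    fun n => hm.rpow_mul_relaxation_le (E.lam_pos n) ht hp0 hp1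
  have hcoeff : ∀ (ψ : E.HScale s) (n : ℕ),
      (resolvent E m μ t ψ.coeff).coeff n = relaxation m t (E.lam n) * ψ.coeff n :=
    fun ψ => hm.coeff_resolvent hμ ht.le hC (hx ψ)
  let A₀ : E.HScale s →ₗ[ℝ] E.H μ :=
    { toFun := fun ψ => resolvent E m μ t ψ.coeff
      map_add' := fun φ ψ => H.ext_coeff fun n => by
        rw [H.coeff_add, hcoeff, hcoeff, hcoeff, HScale.coeff_add, mul_add]
      map_smul' := fun a ψ => H.ext_coeff fun n => by
        rw [RingHom.id_apply, H.coeff_smul, hcoeff, hcoeff, HScale.coeff_smul]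
        ring }
  have hnorm : ∀ ψ, ‖A₀ ψ‖ ≤ t ^ (-p) * ‖ψ‖ := by
    intro ψ
    rw [← HScale.norm_weighted]
    refine H.norm_le_of_coeff (by positivity) fun n => ?_
    change ‖E.lam n ^ (μ / 2) * (resolvent E m μ t ψ.coeff).coeff n‖ ≤ _
    rw [hcoeff]
    exact hm.norm_weight_mul_relaxation_le ht.le hC (hx ψ) n
  exact ⟨A₀.mkContinuous _ hnorm, fun _ =>
    ⟨fun ψ => rfl, A₀.mkContinuous_norm_le (by positivity) hnorm⟩⟩

/-- As `p < 1`, the singularity `t^{-p}` is integrable and the resolvent family is an admissible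
kernel. -/
theorem IsMemoryKernel.isVolterraKernel_resolvent (hm : IsMemoryKernel m) (hμ : 0 ≤ μ)
    (hp0 : 0 ≤ p) (hp1 : p < 1) {s : ℝ} (hs : s = μ - 2 * p) {T : ℝ} (hT : 0 ≤ T)
    {A : ℝ → E.HScale s →L[ℝ] E.H μ} (hA : ∀ t, 0 < t →
      (∀ ψ, A t ψ = resolvent E m μ t ψ.coeff) ∧ ‖A t‖ ≤ t ^ (-p)) :
    IsVolterraKernel A (fun t => t ^ (-p)) T where
  integrableOn :=
    ((intervalIntegrable_iff_integrableOn_Ioo_of_le hT).mp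
      (intervalIntegral.intervalIntegrable_rpow' (by linarith)))
  bound := fun σ hσ => (hA σ hσ.1).2
  aestronglyMeasurable := by
    intro v hv
    refine ContinuousOn.aestronglyMeasurable (fun σ₀ hσ₀ => ?_) measurableSet_Ioo
    refine ContinuousAt.continuousWithinAt ?_
    have h0 : (0 : ℝ) < σ₀ := hσ₀.1
    have hJ : Ici (σ₀ / 2) ∈ 𝓝 σ₀ := Ici_mem_nhds (by linarith)
    have hle : ∀ σ ∈ Ici (σ₀ / 2), σ ^ (-p) ≤ (σ₀ / 2) ^ (-p) := fun σ hσ =>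
      Real.rpow_le_rpow_of_nonpos (by positivity) hσ (by linarith)
    have hJ0 : ∀ σ ∈ Ici (σ₀ / 2), 0 < σ := fun σ hσ => by
      have : σ₀ / 2 ≤ σ := hσ
      linarith
    -- strong continuity at `σ₀`, for the fixed vector `v σ₀`
    have h1 : ContinuousAt (fun σ => A σ (v σ₀)) σ₀ := by
      have hc : ContinuousOn (fun σ => resolvent E m μ σ (v σ₀).coeff) (Ici (σ₀ / 2)) :=
        hm.continuousOn_resolvent (p := p) (C := (σ₀ / 2) ^ (-p))
          (x := HScale.weighted E s (v σ₀)) hμ (fun σ hσ => (hJ0 σ hσ).le)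
          (fun σ hσ n => (hm.rpow_mul_relaxation_le (E.lam_pos n) (hJ0 σ hσ) hp0 hp1.le).trans
            (hle σ hσ)) fun n => by
          rw [HScale.weighted_apply, show s / 2 = μ / 2 - p by rw [hs]; ring]
      refine (hc.continuousAt hJ).congr ?_
      filter_upwards [hJ] with σ hσ
      exact ((hA σ (hJ0 σ hσ)).1 _).symm
    -- the remainder is controlled by the local bound on the operator norms
    have h2 : Tendsto (fun σ => A σ (v σ - v σ₀)) (𝓝 σ₀) (𝓝 0) := by
      have h3 : Tendsto (fun σ => (σ₀ / 2) ^ (-p) * ‖v σ - v σ₀‖) (𝓝 σ₀) (𝓝 0) := by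
        have h4 : Continuous fun σ => (σ₀ / 2) ^ (-p) * ‖v σ - v σ₀‖ := by fun_prop
        simpa using h4.tendsto σ₀
      refine squeeze_zero_norm' ?_ h3
      filter_upwards [hJ] with σ hσ
      exact ContinuousLinearMap.le_of_opNorm_le _
        (((hA σ (hJ0 σ hσ)).2).trans (hle σ hσ)) _
    have h5 := h2.add h1
    simp only [map_sub, sub_add_cancel, zero_add] at h5
    exact h5

/-- The integrals with `A` and with `S` agree, as the integrands can differ at `τ = t` only. -/
theorem volterra_eq_integral_resolvent {s : ℝ} {A : ℝ → E.HScale s →L[ℝ] E.H μ}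
    (hA : ∀ t, 0 < t → ∀ ψ, A t ψ = resolvent E m μ t ψ.coeff) {g : ℝ → E.HScale s} (ht : 0 ≤ t) :
    volterra A g t = ∫ τ in (0 : ℝ)..t, resolvent E m μ (t - τ) (g τ).coeff := by
  rw [volterra, intervalIntegral.integral_of_le ht, intervalIntegral.integral_of_le ht,
    integral_Ioc_eq_integral_Ioo, integral_Ioc_eq_integral_Ioo]
  exact setIntegral_congr_fun measurableSet_Ioo fun τ hτ => hA (t - τ) (by linarith [hτ.2]) _

end Resolvent

/-- The history operator is the Volterra operator with the scalar kernel `ℓ`. -/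
theorem isVolterraKernel_smul_id {X : Type*} [NormedAddCommGroup X] [NormedSpace ℝ X] {l : ℝ → ℝ}
    {T : ℝ} (hl : IntegrableOn l (Ioo 0 T)) :
    IsVolterraKernel (fun t => l t • ContinuousLinearMap.id ℝ X) (fun t => ‖l t‖) T where
  integrableOn := hl.norm
  bound := fun σ _ => by
    rw [norm_smul]
    exact mul_le_of_le_one_right (norm_nonneg _) ContinuousLinearMap.norm_id_le
  aestronglyMeasurable := fun v hv => by
    exact hl.aestronglyMeasurable.smul hv.aestronglyMeasurable

theorem volterra_smul_id {X : Type*} [NormedAddCommGroup X] [NormedSpace ℝ X] (l : ℝ → ℝ)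
    (u : ℝ → X) (t : ℝ) :
    volterra (fun t => l t • ContinuousLinearMap.id ℝ X) u t = history l u t := by
  simp [volterra, history]

end RayleighStokes

theorem theorem3p2 {d : ℕ} (Ω : Set (EuclideanSpace ℝ (Fin d)))
    (hΩ_open : IsOpen Ω) (hΩ_conn : IsConnected Ω) (hΩ_bdd : Bornology.IsBounded Ω)
    (E : RayleighStokes.DirichletEigenbasis Ω)
    (m : ℝ → ℝ) (hm : RayleighStokes.IsMemoryKernel m)
    (T : ℝ) (hT : 0 < T)
    (l : ℝ → ℝ) (hl : IntegrableOn l (Ioo 0 T))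
    (μ δ : ℝ) (hμ : 0 < μ) (hδ : δ ∈ Ioo (0 : ℝ) 1)
    (f : E.H μ × E.H μ → E.HScale (μ - 1 - δ)) (hf : Continuous f)
    (Lf Kf : ℝ) (hLf : 0 ≤ Lf) (hKf : 0 ≤ Kf)
    (hLip : ∀ v₁ v₂ w₁ w₂ : E.H μ,
      ‖f (v₁, w₁) - f (v₂, w₂)‖ ≤ Lf * ‖v₁ - v₂‖ + Kf * ‖w₁ - w₂‖)
    (ξ : E.H μ) :
    ∃! u : C(Icc (0 : ℝ) T, E.H μ),
      RayleighStokes.IsMildSolution E m l T μ (μ - 1 - δ) f ξ (IccExtend hT.le u) := by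
  have := RayleighStokes.DirichletEigenbasis.H.completeSpace E hμ.le
  -- `S(t)` gains `1 + δ` orders of regularity, that is `λ^p` with `p = (1 + δ) / 2 < 1`
  have hp0 : (0 : ℝ) ≤ (1 + δ) / 2 := by linarith [hδ.1]
  have hp1 : (1 + δ) / 2 < 1 := by linarith [hδ.2]
  have hs : μ - 1 - δ = μ - 2 * ((1 + δ) / 2) := by ring
  obtain ⟨A, hA⟩ := hm.exists_resolventCLM (E := E) hμ.le hp0 hp1.le hs
  have hξ : ContinuousOn (fun t => RayleighStokes.resolvent E m μ t ξ.coeff) (Icc 0 T) :=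
    hm.continuousOn_resolvent (p := 0) (C := 1)
      (x := RayleighStokes.DirichletEigenbasis.H.weighted E μ ξ) hμ.le Icc_subset_Ici_self
      (fun t ht n => by simpa using hm.relaxation_le_one (E.lam_pos n) ht.1)
      (fun n => by rw [RayleighStokes.DirichletEigenbasis.H.weighted_apply, sub_zero])
  have key := RayleighStokes.existsUnique_volterra_fixedPoint hT.le
    (hm.isVolterraKernel_resolvent hμ.le hp0 hp1 hs hT.le hA)
    (RayleighStokes.isVolterraKernel_smul_id hl) hf hLf hKf hLip hξ
  simp only [RayleighStokes.volterra_smul_id] at key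
  -- `IsMildSolution` is the fixed point equation with `A` in place of `S`
  refine (existsUnique_congr fun u => forall₂_congr fun t ht => ?_).mp key
  rw [RayleighStokes.volterra_eq_integral_resolvent (fun σ hσ => (hA σ hσ).1) ht.1]
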